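/- A \emph{tile} is a closed, simply connected polygon in $\mathbb R^2$ all of whose sides are parallel to the coordinate axes; it is \emph{tall} if its height is $1$. A \emph{tiling} of a region $\Gamma\subset\mathbb R^2$ with a finite set $T$ of tiles is a collection of translates of tiles of $T$ whose interiors are pairwise disjoint and whose union is $\Gamma$. A function $f:\mathbb N\to\mathbb N$, where $\mathbb N=\{0,1,2,\dots\}$, is a \emph{tile counting function} if there are a real number $\varepsilon\ge 0$ and a finite set $T$ of tall tiles such that, for every $n\in\mathbb N$, $f(n)$ is the number of tilings with $T$ of the rectangle $[0,n+\varepsilon]\times[0,1]$ (a rectangle of length $0$ being regarded as the empty region, which has exactly one tiling, the empty one). For a prime $p$ and an integer $m\geq 1$ put $\operatorname{ord}_p(m)=\max\{d\ge 0: p^d\mid m\}$, and let $C_n=\frac1{n+1}\binom{2n}{n}$ be the $n$-th Catalan number. For every prime $p$ there exists a tile counting function $f$ with $f(n)\ge 1$ and $\operatorname{ord}_p(f(n))=\operatorname{ord}_p(C_n)$ for all $n\in\mathbb N$. Moreover, one such function is $$f(n)=\binom{2n}{n}+\left(p^{2n}-1\right)\binom{2n}{n+1}.$$ -/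

import Mathlib

namespace IrrationalTiling

/-- A tile: an axis-parallel simply connected closed polygon in the plane, i.e. a finite union of
nondegenerate closed axis-parallel rectangles which is simply connected and has connected interior.
(Connectedness of the interior excludes pieces that touch only at a corner; together with simple
connectedness it makes the tile a topological closed disc.) -/
structure IsTile (τ : Set (ℝ × ℝ)) : Prop where
  rectilinear : ∃ S : Set (Set (ℝ × ℝ)), S.Finite ∧
    (∀ r ∈ S, ∃ a b c d : ℝ, a < b ∧ c < d ∧ r = Set.Icc a b ×ˢ Set.Icc c d) ∧ τ = ⋃₀ S
  simplyConnected : SimplyConnectedSpace τ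
  interior_connected : IsConnected (interior τ)

/-- A tall tile: a tile of height `1`. -/
structure IsTallTile (τ : Set (ℝ × ℝ)) : Prop extends IsTile τ where
  height_one : ∃ c : ℝ, Prod.snd '' τ = Set.Icc c (c + 1)

/-- `P` is a tiling of the region `Γ` with the set of tiles `T`: a collection of translates of
tiles of `T`, non-overlapping (the interiors are pairwise disjoint), whose union is `Γ`. -/
structure IsTiling (T : Set (Set (ℝ × ℝ))) (Γ : Set (ℝ × ℝ)) (P : Set (Set (ℝ × ℝ))) : Prop where
  translates : ∀ A ∈ P, ∃ τ ∈ T, ∃ v : ℝ × ℝ, A = (fun z => v + z) '' τ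
  nonoverlapping : P.Pairwise fun A B => Disjoint (interior A) (interior B)
  covers : ⋃₀ P = Γ

/-- The number of tilings of `Γ` with `T`. -/
noncomputable def numTilings (T : Set (Set (ℝ × ℝ))) (Γ : Set (ℝ × ℝ)) : ℕ∞ :=
  {P : Set (Set (ℝ × ℝ)) | IsTiling T Γ P}.encard

open Classical in
/-- The rectangle `[1 × a]` of height `1` and length `a`. The degenerate rectangle of length `0`
is the empty region (it has exactly one tiling by tiles, the empty one). -/
noncomputable def rect (a : ℝ) : Set (ℝ × ℝ) :=
  if 0 < a then Set.Icc 0 a ×ˢ Set.Icc 0 1 else ∅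

/-- `f` is a tile counting function: for some fixed `ε ≥ 0` and some finite set `T` of tall tiles,
`f n` is the number of tilings of `[1 × (n + ε)]` with `T`, for all `n`. -/
def IsTileCountingFunction (f : ℕ → ℕ) : Prop :=
  ∃ (ε : ℝ) (T : Set (Set (ℝ × ℝ))), 0 ≤ ε ∧ T.Finite ∧ (∀ τ ∈ T, IsTallTile τ) ∧
    ∀ n : ℕ, (f n : ℕ∞) = numTilings T (rect (n + ε))

/-- The function `n ↦ binom(2n, n) + (p^(2n) - 1) * binom(2n, n + 1)`. The subtraction does not
truncate when `p` is positive. -/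
def catalanLike (p n : ℕ) : ℕ :=
  (2 * n).choose n + (p ^ (2 * n) - 1) * (2 * n).choose (n + 1)

end IrrationalTiling

/-! A tall tile made of a lower and an upper box with displaced sides can be followed only by a tile
with the same displacement. Encode the vertices of a finite weighted graph by distinct small
displacements, and its edges by tiles whose lengths are the images of the weights under an injective
additive map `φ`. Then the tilings of the rectangle of length `φ t` are the closed walks of
weight `t` at the vertex without displacement.

With the lengths `1 / 2 - x`, `1 / 2 + x`, `1 / 2 + 3 * x` and `x ^ 2`, where `x` is transcendental,
a tiling of the rectangle of length `n + 2 * x ^ 2` spells one word of `2 * n` bits, each in one of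
`p` colours. The bits have sum `n` if all of them have the default colour; otherwise one is added
to the sum of bits on the way, so they have sum `n - 1`. The number of such words is
`catalanLike p n`. It equals `catalan n * (1 + n * p ^ (2 * n))`, and the second factor is coprime
to `p`. -/

namespace IrrationalTiling

open MeasureTheory
open scoped Pointwise Topology

/-- Contracting an open subset of `s` towards `c` produces an open subset of `s`. -/
theorem starConvex_interior {E : Type*} [AddCommGroup E] [Module ℝ E] [TopologicalSpace E]
    [IsTopologicalAddGroup E] [ContinuousConstSMul ℝ E] {s : Set E} {c : E}
    (hs : StarConvex ℝ c s) (hc : c ∈ interior s) : StarConvex ℝ c (interior s) := by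
  intro x hx a b ha hb hab
  rcases hb.eq_or_lt with rfl | hb
  · simpa [show a = 1 by linarith] using hc
  · have hopen : IsOpen (a • c +ᵥ b • interior s) := (isOpen_interior.smul₀ hb.ne').vadd _
    refine interior_maximal ?_ hopen ⟨b • x, ⟨x, hx, rfl⟩, rfl⟩
    rintro _ ⟨_, ⟨y, hy, rfl⟩, rfl⟩
    exact hs (interior_subset hy) ha hb.le hab

theorem IsTiling.subset {T : Set (Set (ℝ × ℝ))} {Γ : Set (ℝ × ℝ)} {P : Set (Set (ℝ × ℝ))}
    (h : IsTiling T Γ P) {A : Set (ℝ × ℝ)} (hA : A ∈ P) : A ⊆ Γ :=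
  h.covers ▸ Set.subset_sUnion_of_mem hA

theorem IsTiling.finite {T : Set (Set (ℝ × ℝ))} {Γ : Set (ℝ × ℝ)} {P : Set (Set (ℝ × ℝ))}
    (hP : IsTiling T Γ P) (hT : T.Finite) (hint : ∀ τ ∈ T, (interior τ).Nonempty)
    (hΓ : volume Γ ≠ ⊤) : P.Finite := by
  have hsub : P ⊆ ⋃ τ ∈ T,
      Subtype.val '' {A : P | volume (interior τ) ≤ volume (interior A.1)} := by
    intro A hA
    obtain ⟨τ, hτ, v, rfl⟩ := hP.translates A hA
    refine Set.mem_biUnion hτ ⟨⟨_, hA⟩, ?_, rfl⟩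
    change _ ≤ volume (interior (v +ᵥ τ))
    rw [interior_vadd, measure_vadd]
  refine (hT.biUnion fun τ hτ => Set.Finite.image _ ?_).subset hsub
  refine Measure.finite_const_le_meas_of_disjoint_iUnion volume
    (isOpen_interior.measure_pos volume (hint τ hτ))
    (fun A => isOpen_interior.measurableSet)
    (fun A B hAB => hP.nonoverlapping A.2 B.2 (Subtype.coe_ne_coe.2 hAB))
    (ne_top_of_le_ne_top hΓ (measure_mono ?_))
  exact Set.iUnion_subset fun A => interior_subset.trans (hP.subset A.2)

/-- The lower (`i = 0`) and the upper (`i = 1`) half of the unit interval of heights. -/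
def row (i : Fin 2) : Set ℝ := Set.Icc ((i : ℕ) / 2) (((i : ℕ) + 1) / 2)

/-- The height halfway up the row `i`, where a tile made of boxes in the two rows shows only its
box in the row `i`. -/
noncomputable def rowMid (i : Fin 2) : ℝ := (i : ℕ) / 2 + 1 / 4

theorem rowMid_mem_row_iff {i j : Fin 2} : rowMid i ∈ row j ↔ i = j := by
  fin_cases i <;> fin_cases j <;> norm_num [rowMid, row]

theorem rowMid_mem_interior_row (i : Fin 2) : rowMid i ∈ interior (row i) := by
  fin_cases i <;> norm_num [rowMid, row]

theorem half_mem_row (i : Fin 2) : 1 / 2 ∈ row i := by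
  fin_cases i <;> norm_num [row]

theorem eq_half_of_mem_row_of_ne {i j : Fin 2} (hij : i ≠ j) {y : ℝ} (hi : y ∈ row i)
    (hj : y ∈ row j) : y = 1 / 2 := by
  fin_cases i <;> fin_cases j <;> simp [row] at hij hi hj ⊢ <;> linarith

theorem iUnion_row : ⋃ i, row i = Set.Icc 0 1 := by
  ext y
  simp only [row, Set.mem_iUnion, Fin.exists_fin_two, Set.mem_Icc]
  norm_num
  grind

/-- A position of a tile that consists of one box in each of the two rows: its left and right
sides in each row. -/
@[ext]
structure StepTile where
  left : Fin 2 → ℝ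
  right : Fin 2 → ℝ

namespace StepTile

variable {s t : StepTile}

/-- The point set of a step tile. -/
def shape (t : StepTile) : Set (ℝ × ℝ) := ⋃ i, Set.Icc (t.left i) (t.right i) ×ˢ row i

/-- The step tile moved to the right by `x`. -/
def translate (x : ℝ) (t : StepTile) : StepTile := ⟨fun i => x + t.left i, fun i => x + t.right i⟩

/-- Every left side lies to the left of every right side, so that the boxes of the two rows overlap
along a segment; this makes the tile a topological disc and forces non-overlapping tiles to come in
the same order in both rows. -/
def IsThick (t : StepTile) : Prop := ∀ i j, t.left i < t.right j

theorem mem_shape {z : ℝ × ℝ} :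
    z ∈ t.shape ↔ ∃ i, z.1 ∈ Set.Icc (t.left i) (t.right i) ∧ z.2 ∈ row i := by
  simp only [shape, Set.mem_iUnion, Set.mem_prod]

theorem mk_rowMid_mem_shape {x : ℝ} {i : Fin 2} :
    (x, rowMid i) ∈ t.shape ↔ x ∈ Set.Icc (t.left i) (t.right i) := by
  simp only [mem_shape, rowMid_mem_row_iff, exists_eq_right']

theorem mk_rowMid_mem_interior_shape {x : ℝ} {i : Fin 2}
    (hx : x ∈ Set.Ioo (t.left i) (t.right i)) : (x, rowMid i) ∈ interior t.shape := by
  refine interior_mono (Set.subset_iUnion _ i) ?_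
  rw [interior_prod_eq, interior_Icc]
  exact ⟨hx, rowMid_mem_interior_row i⟩

theorem shape_translate (x : ℝ) (t : StepTile) :
    (t.translate x).shape = (fun z => (x, (0 : ℝ)) + z) '' t.shape := by
  ext z
  simp only [Set.image_add_left, Set.mem_preimage, mem_shape, translate, Set.mem_Icc, Prod.fst_add,
    Prod.snd_add, Prod.fst_neg, Prod.snd_neg, neg_zero, zero_add, le_neg_add_iff_add_le,
    neg_add_le_iff_le_add]

theorem IsThick.translate (ht : t.IsThick) (x : ℝ) : (t.translate x).IsThick :=
  fun i j => add_lt_add_right (ht i j) x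

theorem IsThick.shape_injOn : Set.InjOn shape {t | t.IsThick} := by
  intro s hs t _ hst
  have hsides (i : Fin 2) : s.left i = t.left i ∧ s.right i = t.right i := by
    refine (Set.Icc_eq_Icc_iff (hs i i).le).1 (Set.ext fun x => ?_)
    rw [← mk_rowMid_mem_shape, hst, mk_rowMid_mem_shape]
  exact StepTile.ext (funext fun i => (hsides i).1) (funext fun i => (hsides i).2)

theorem IsThick.exists_common_point (ht : t.IsThick) :
    ∃ x, ∀ i, x ∈ Set.Ioo (t.left i) (t.right i) := by
  have hlt : max (t.left 0) (t.left 1) < min (t.right 0) (t.right 1) :=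
    max_lt (lt_min (ht 0 0) (ht 0 1)) (lt_min (ht 1 0) (ht 1 1))
  obtain ⟨x, hleft, hright⟩ := exists_between hlt
  rw [max_lt_iff] at hleft
  rw [lt_min_iff] at hright
  exact ⟨x, Fin.forall_fin_two.2 ⟨⟨hleft.1, hright.1⟩, hleft.2, hright.2⟩⟩

theorem starConvex_shape {x : ℝ} (hx : ∀ i, x ∈ Set.Icc (t.left i) (t.right i)) :
    StarConvex ℝ (x, (1 / 2 : ℝ)) t.shape :=
  starConvex_iUnion fun i =>
    ((convex_Icc _ _).prod (convex_Icc _ _)).starConvex ⟨hx i, half_mem_row i⟩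

theorem mk_half_mem_interior_shape {x : ℝ} (hx : ∀ i, x ∈ Set.Ioo (t.left i) (t.right i)) :
    (x, (1 / 2 : ℝ)) ∈ interior t.shape := by
  have hsub : (⋂ i, Set.Ioo (t.left i) (t.right i)) ×ˢ Set.Ioo 0 1 ⊆ t.shape := by
    rintro z ⟨hz₁, hz₂⟩
    obtain ⟨i, hi⟩ := Set.mem_iUnion.1 (iUnion_row ▸ Set.Ioo_subset_Icc_self hz₂)
    exact mem_shape.2 ⟨i, Set.Ioo_subset_Icc_self (Set.mem_iInter.1 hz₁ i), hi⟩
  refine interior_maximal hsub ((isOpen_iInter_of_finite fun i => isOpen_Ioo).prod isOpen_Ioo)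
    ⟨Set.mem_iInter.2 hx, ?_⟩
  norm_num

theorem IsThick.snd_image_shape (ht : t.IsThick) : Prod.snd '' t.shape = Set.Icc 0 1 := by
  rw [shape, Set.image_iUnion, ← iUnion_row]
  exact Set.iUnion_congr fun i => Set.snd_image_prod (Set.nonempty_Icc.2 (ht i i).le) _

theorem IsThick.isTallTile (ht : t.IsThick) : IsTallTile t.shape := by
  obtain ⟨x, hx⟩ := ht.exists_common_point
  have hstar := starConvex_shape fun i => Set.Ioo_subset_Icc_self (hx i)
  have hmem := mk_half_mem_interior_shape hx
  have hcontr : ContractibleSpace t.shape :=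
    hstar.contractibleSpace ⟨_, interior_subset hmem⟩
  have hconn : IsConnected (interior t.shape) :=
    ((starConvex_interior hstar hmem).isPathConnected hmem).isConnected
  refine ⟨⟨⟨Set.range fun i => Set.Icc (t.left i) (t.right i) ×ˢ row i, Set.finite_range _, ?_,
    rfl⟩, inferInstance, hconn⟩, 0, ?_⟩
  · rintro _ ⟨i, rfl⟩
    exact ⟨_, _, _, _, ht i i, by linarith, rfl⟩
  · rw [zero_add, ht.snd_image_shape]

theorem disjoint_interior_shape_of_right_le_left (h : s.right ≤ t.left) :
    Disjoint (interior s.shape) (interior t.shape) := by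
  have hsub : s.shape ∩ t.shape ⊆ Set.range s.right ×ˢ Set.univ ∪ Set.univ ×ˢ {1 / 2} := by
    rintro z ⟨hzs, hzt⟩
    obtain ⟨i, hi, hzi⟩ := mem_shape.1 hzs
    obtain ⟨j, hj, hzj⟩ := mem_shape.1 hzt
    rcases eq_or_ne i j with rfl | hij
    · exact Or.inl ⟨⟨i, ((h i).trans hj.1).antisymm hi.2⟩, trivial⟩
    · exact Or.inr ⟨trivial, eq_half_of_mem_row_of_ne hij hzi hzj⟩
  rw [Set.disjoint_iff_inter_eq_empty, ← interior_inter]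
  refine volume.interior_eq_empty_of_null (measure_mono_null hsub ?_)
  simp [Measure.volume_eq_prod, (Set.finite_range s.right).measure_zero]

theorem IsThick.disjoint_interior_shape_iff (hs : s.IsThick) (ht : t.IsThick) :
    Disjoint (interior s.shape) (interior t.shape) ↔ s.right ≤ t.left ∨ t.right ≤ s.left := by
  refine ⟨fun h => ?_, fun h => h.elim disjoint_interior_shape_of_right_le_left
    fun h => (disjoint_interior_shape_of_right_le_left h).symm⟩
  have hrow (i : Fin 2) : s.right i ≤ t.left i ∨ t.right i ≤ s.left i := by
    by_contra! hlt
    obtain ⟨x, hl, hr⟩ := exists_between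
      (max_lt (lt_min (hs i i) hlt.2) (lt_min hlt.1 (ht i i)))
    rw [max_lt_iff] at hl
    rw [lt_min_iff] at hr
    exact Set.disjoint_left.1 h (mk_rowMid_mem_interior_shape ⟨hl.1, hr.1⟩)
      (mk_rowMid_mem_interior_shape ⟨hl.2, hr.2⟩)
  have hcons {i j : Fin 2} (hi : s.right i ≤ t.left i) (hj : t.right j ≤ s.left j) : False :=
    ((hs j i).trans_le hi).not_ge ((ht i j).le.trans hj)
  by_cases h₀ : s.right 0 ≤ t.left 0
  · exact Or.inl fun j => (hrow j).resolve_right (hcons h₀)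
  · exact Or.inr fun j => (hrow j).resolve_left
      fun hj => hcons hj ((hrow 0).resolve_left h₀)

/-- The step tiles in `Q` fill the part of the strip between the broken vertical lines `u` and `v`,
with no overlaps. -/
structure Fills (Q : Set StepTile) (u v : Fin 2 → ℝ) : Prop where
  le : u ≤ v
  pairwise : Q.Pairwise fun s t => s.right ≤ t.left ∨ t.right ≤ s.left
  le_left : ∀ t ∈ Q, u ≤ t.left
  right_le : ∀ t ∈ Q, t.right ≤ v
  cover : ∀ i, Set.Ioo (u i) (v i) ⊆ ⋃ t ∈ Q, Set.Icc (t.left i) (t.right i)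

/-- The tiles of the list `w` join the broken vertical line `u` to `v`: each tile starts where the
preceding one ends. -/
def Spans : (Fin 2 → ℝ) → List StepTile → (Fin 2 → ℝ) → Prop
  | u, [], v => u = v
  | u, t :: w, v => t.left = u ∧ Spans t.right w v

variable {Q : Set StepTile} {u v : Fin 2 → ℝ} {w : List StepTile}

theorem Fills.Icc_subset (h : Fills Q u v) (hQ : Q.Finite) {i : Fin 2} (hi : u i < v i) :
    Set.Icc (u i) (v i) ⊆ ⋃ t ∈ Q, Set.Icc (t.left i) (t.right i) := by
  rw [← closure_Ioo hi.ne]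
  exact closure_minimal (h.cover i) (hQ.isClosed_biUnion fun t _ => isClosed_Icc)

theorem Fills.insert (h : Fills Q t.right v) (ht : t.IsThick) : Fills (insert t Q) t.left v where
  le := fun i => (ht i i).le.trans (h.le i)
  pairwise := h.pairwise.insert fun s hs _ => ⟨Or.inl (h.le_left s hs), Or.inr (h.le_left s hs)⟩
  le_left := Set.forall_mem_insert.2
    ⟨le_rfl, fun s hs i => (ht i i).le.trans (h.le_left s hs i)⟩
  right_le := Set.forall_mem_insert.2 ⟨h.le, h.right_le⟩
  cover i x hx := by
    rw [Set.biUnion_insert]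
    rcases le_or_gt x (t.right i) with hxt | hxt
    · exact Or.inl ⟨hx.1.le, hxt⟩
    · exact Or.inr (h.cover i ⟨hxt, hx.2⟩)

theorem Spans.fills (h : Spans u w v) (hw : ∀ t ∈ w, t.IsThick) : Fills {t | t ∈ w} u v := by
  induction w generalizing u with
  | nil =>
    obtain rfl : u = v := h
    exact ⟨le_rfl, by simp, by simp, by simp, by simp⟩
  | cons t w ih =>
    obtain ⟨rfl, h⟩ := h
    rw [List.forall_mem_cons] at hw
    rw [show {s | s ∈ t :: w} = insert t {s | s ∈ w} from Set.ext fun _ => List.mem_cons]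
    exact (ih h hw.2).insert hw.1

theorem Fills.eq_of_empty (h : Fills ∅ u v) : u = v := by
  refine h.le.antisymm fun i => ?_
  simpa only [Set.mem_empty_iff_false, Set.iUnion_of_empty, Set.iUnion_empty,
    Set.subset_empty_iff, Set.Ioo_eq_empty_iff, not_lt] using h.cover i

theorem exists_leftmost (hQ : Q.Finite) (hne : Q.Nonempty) (hthick : ∀ t ∈ Q, t.IsThick)
    (hpair : Q.Pairwise fun s t => s.right ≤ t.left ∨ t.right ≤ s.left) :
    ∃ m ∈ Q, ∀ t ∈ Q, t ≠ m → m.right ≤ t.left := by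
  obtain ⟨m, hm, hmin⟩ := Set.exists_min_image Q (fun t => t.left 0) hQ hne
  refine ⟨m, hm, fun t ht htm => (hpair hm ht htm.symm).resolve_right fun hle => ?_⟩
  exact ((hthick t ht 0 0).trans_le (hle 0)).not_ge (hmin t ht)

theorem Fills.exists_first (h : Fills Q u v) (hQ : Q.Finite) (hne : Q.Nonempty)
    (hthick : ∀ t ∈ Q, t.IsThick) : ∃ m ∈ Q, m.left = u ∧ Fills (Q \ {m}) m.right v := by
  obtain ⟨m, hm, hfirst⟩ := exists_leftmost hQ hne hthick h.pairwise
  have hleft : m.left ≤ u := by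
    intro i
    by_contra! hlt
    obtain ⟨x, hux, hxm⟩ := exists_between hlt
    obtain ⟨t, ht, hxt⟩ := Set.mem_iUnion₂.1 <| h.cover i
      ⟨hux, hxm.trans ((hthick m hm i i).trans_le (h.right_le m hm i))⟩
    rcases eq_or_ne t m with rfl | htm
    · exact hxm.not_ge hxt.1
    · exact (hxm.trans (hthick m hm i i)).not_ge ((hfirst t ht htm i).trans hxt.1)
  refine ⟨m, hm, hleft.antisymm (h.le_left m hm), h.right_le m hm, h.pairwise.mono Set.sdiff_subset,
    fun t ht => hfirst t ht.1 ht.2, fun t ht => h.right_le t ht.1, fun i x hx => ?_⟩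
  obtain ⟨t, ht, hxt⟩ := Set.mem_iUnion₂.1 <| h.cover i
    ⟨((h.le_left m hm i).trans (hthick m hm i i).le).trans_lt hx.1, hx.2⟩
  exact Set.mem_iUnion₂.2 ⟨t, ⟨ht, fun htm => hx.1.not_ge (htm ▸ hxt.2)⟩, hxt⟩

theorem Fills.exists_spans (h : Fills Q u v) (hQ : Q.Finite) (hthick : ∀ t ∈ Q, t.IsThick) :
    ∃ w, Spans u w v ∧ {t | t ∈ w} = Q := by
  induction hn : Q.ncard generalizing Q u with
  | zero =>
    obtain rfl := (Set.ncard_eq_zero hQ).1 hn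
    exact ⟨[], h.eq_of_empty, by simp⟩
  | succ n ih =>
    obtain ⟨m, hm, rfl, hrest⟩ := h.exists_first hQ (Set.nonempty_of_ncard_ne_zero (by lia)) hthick
    obtain ⟨w, hw, hwQ⟩ := ih hrest hQ.sdiff (fun t ht => hthick t ht.1)
      (by rw [Set.ncard_sdiff_singleton_of_mem hm, hn, Nat.add_sub_cancel])
    refine ⟨m :: w, ⟨rfl, hw⟩, ?_⟩
    rw [← Set.insert_sdiff_self_of_mem hm, ← hwQ]
    ext t
    exact List.mem_cons

theorem Spans.pairwise (h : Spans u w v) (hw : ∀ t ∈ w, t.IsThick) :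
    w.Pairwise fun s t => s.right ≤ t.left := by
  induction w generalizing u with
  | nil => exact List.Pairwise.nil
  | cons t w ih =>
    rw [List.forall_mem_cons] at hw
    exact List.pairwise_cons.2 ⟨(h.2.fills hw.2).le_left, ih h.2 hw.2⟩

theorem Spans.eq_of_mem_iff {u' v' : Fin 2 → ℝ} {w' : List StepTile} (h : Spans u w v)
    (h' : Spans u' w' v') (hw : ∀ t ∈ w, t.IsThick) (hmem : ∀ t, t ∈ w ↔ t ∈ w') : w = w' := by
  have hw' : ∀ t ∈ w', t.IsThick := fun t ht => hw t ((hmem t).2 ht)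
  have hnodup {u v : Fin 2 → ℝ} {w : List StepTile} (h : Spans u w v)
      (hw : ∀ t ∈ w, t.IsThick) : w.Nodup :=
    (h.pairwise hw).imp_of_mem fun hs _ hle hst => by
      subst hst
      exact (hw _ hs 0 0).not_ge (hle 0)
  refine ((List.perm_ext_iff_of_nodup (hnodup h hw) (hnodup h' hw')).2 hmem).eq_of_pairwise
    (fun s t hs ht hst hts => ?_) (h.pairwise hw) (h'.pairwise hw')
  exact absurd ((hw s hs 0 0).trans_le (hst 0)) ((hw' t ht 0 0).le.trans (hts 0)).not_gt

/-- The horizontal translates of the step tiles in `S`. -/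
def translates (S : Set StepTile) : Set StepTile := ⋃ x, translate x '' S

variable {S : Set StepTile} {L : ℝ} {P : Set (Set (ℝ × ℝ))}

theorem mem_translates : t ∈ translates S ↔ ∃ x, ∃ s ∈ S, s.translate x = t := by
  simp only [translates, Set.mem_iUnion, Set.mem_image]

theorem isThick_of_mem_translates (hS : ∀ s ∈ S, s.IsThick) (ht : t ∈ translates S) :
    t.IsThick := by
  obtain ⟨x, s, hs, rfl⟩ := mem_translates.1 ht
  exact (hS s hs).translate x

theorem rect_of_pos (hL : 0 < L) : rect L = Set.Icc 0 L ×ˢ ⋃ i, row i := by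
  rw [rect, if_pos hL, iUnion_row]

theorem Fills.isTiling (h : Fills Q 0 fun _ => L) (hL : 0 < L) (hQ : Q.Finite)
    (hS : ∀ s ∈ S, s.IsThick) (hQS : Q ⊆ translates S) :
    IsTiling (shape '' S) (rect L) (shape '' Q) where
  translates := by
    rintro _ ⟨t, ht, rfl⟩
    obtain ⟨x, s, hs, rfl⟩ := mem_translates.1 (hQS ht)
    exact ⟨_, ⟨s, hs, rfl⟩, _, shape_translate x s⟩
  nonoverlapping := by
    rintro _ ⟨s, hs, rfl⟩ _ ⟨t, ht, rfl⟩ hst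
    exact (IsThick.disjoint_interior_shape_iff (isThick_of_mem_translates hS (hQS hs))
      (isThick_of_mem_translates hS (hQS ht))).2 (h.pairwise hs ht (ne_of_apply_ne shape hst))
  covers := by
    rw [rect_of_pos hL, Set.sUnion_image]
    ext z
    simp only [Set.mem_iUnion, Set.mem_prod, mem_shape]
    refine ⟨fun ⟨t, ht, i, hi, hz⟩ => ⟨?_, i, hz⟩, fun ⟨hz, i, hi⟩ => ?_⟩
    · exact ⟨(h.le_left t ht i).trans hi.1, hi.2.trans (h.right_le t ht i)⟩
    · obtain ⟨t, ht, hzt⟩ := Set.mem_iUnion₂.1 (h.Icc_subset hQ (i := i) hL hz)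
      exact ⟨t, ht, i, hzt, hi⟩

theorem exists_translate_eq (hs : s.IsThick) {v : ℝ × ℝ}
    (hsub : (fun z => v + z) '' s.shape ⊆ rect L) :
    (fun z => v + z) '' s.shape = (s.translate v.1).shape := by
  have hheight : (fun y => v.2 + y) '' Set.Icc 0 1 ⊆ Set.Icc 0 1 := by
    rw [← hs.snd_image_shape, Set.image_image]
    rintro _ ⟨z, hz, rfl⟩
    have hmem := hsub ⟨z, hz, rfl⟩
    unfold rect at hmem
    split_ifs at hmem
    · exact hs.snd_image_shape ▸ hmem.2
    · exact hmem.elim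
  rw [Set.image_const_add_Icc, Set.Icc_subset_Icc_iff (by linarith)] at hheight
  rw [shape_translate, show v = (v.1, 0) from Prod.ext rfl (by linarith [hheight.1, hheight.2])]

theorem exists_image_shape_eq (hS : ∀ s ∈ S, s.IsThick) (h : IsTiling (shape '' S) (rect L) P) :
    ∃ Q ⊆ translates S, shape '' Q = P := by
  refine ⟨{t ∈ translates S | t.shape ∈ P}, Set.sep_subset _ _, Set.Subset.antisymm ?_ ?_⟩
  · rintro _ ⟨t, ht, rfl⟩
    exact ht.2
  · intro A hA
    obtain ⟨_, ⟨s, hs, rfl⟩, v, rfl⟩ := h.translates A hA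
    have heq := exists_translate_eq (hS s hs) (h.subset hA)
    exact ⟨s.translate v.1, ⟨mem_translates.2 ⟨_, s, hs, rfl⟩, heq ▸ hA⟩, heq.symm⟩

theorem fills_of_isTiling (hL : 0 < L) (hQ : ∀ t ∈ Q, t.IsThick) {T : Set (Set (ℝ × ℝ))}
    (h : IsTiling T (rect L) (shape '' Q)) : Fills Q 0 fun _ => L := by
  have hbox {t : StepTile} (ht : t ∈ Q) {x : ℝ} {i : Fin 2}
      (hx : x ∈ Set.Icc (t.left i) (t.right i)) : x ∈ Set.Icc 0 L := by
    have hmem := h.subset ⟨t, ht, rfl⟩ (mk_rowMid_mem_shape.2 hx)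
    rw [rect_of_pos hL] at hmem
    exact hmem.1
  refine ⟨fun _ => hL.le, fun s hs t ht hst => ?_,
    fun t ht i => (hbox ht (Set.left_mem_Icc.2 (hQ t ht i i).le)).1,
    fun t ht i => (hbox ht (Set.right_mem_Icc.2 (hQ t ht i i).le)).2, fun i x hx => ?_⟩
  · exact ((hQ s hs).disjoint_interior_shape_iff (hQ t ht)).1 <|
      h.nonoverlapping ⟨s, hs, rfl⟩ ⟨t, ht, rfl⟩ (IsThick.shape_injOn.ne (hQ s hs) (hQ t ht) hst)
  · have hmem : (x, rowMid i) ∈ ⋃₀ (shape '' Q) := by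
      rw [h.covers, rect_of_pos hL]
      exact ⟨Set.Ioo_subset_Icc_self hx, Set.mem_iUnion.2 ⟨i, rowMid_mem_row_iff.2 rfl⟩⟩
    obtain ⟨_, ⟨t, ht, rfl⟩, hxt⟩ := hmem
    exact Set.mem_iUnion₂.2 ⟨t, ht, mk_rowMid_mem_shape.1 hxt⟩

theorem isTiling_image_shape_iff (hS : ∀ s ∈ S, s.IsThick) (hfin : S.Finite) (hL : 0 < L) :
    IsTiling (shape '' S) (rect L) P ↔
      ∃ w, (Spans 0 w (fun _ => L) ∧ ∀ t ∈ w, t ∈ translates S) ∧ shape '' {t | t ∈ w} = P := by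
  constructor
  · intro h
    obtain ⟨Q, hQS, rfl⟩ := exists_image_shape_eq hS h
    have hthick : ∀ t ∈ Q, t.IsThick := fun t ht => isThick_of_mem_translates hS (hQS ht)
    have hint : ∀ τ ∈ shape '' S, (interior τ).Nonempty := by
      rintro _ ⟨s, hs, rfl⟩
      exact (hS s hs).isTallTile.interior_connected.nonempty
    have hvol : volume (rect L) ≠ ⊤ := by
      rw [rect, if_pos hL]
      exact (isCompact_Icc.prod isCompact_Icc).measure_ne_top
    have hQ : Q.Finite :=
      (h.finite (hfin.image _) hint hvol).of_finite_image (IsThick.shape_injOn.mono hthick)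
    obtain ⟨w, hw, rfl⟩ := (fills_of_isTiling hL hthick h).exists_spans hQ hthick
    exact ⟨w, ⟨hw, fun t ht => hQS ht⟩, rfl⟩
  · rintro ⟨w, ⟨hw, hwS⟩, rfl⟩
    exact (hw.fills fun t ht => isThick_of_mem_translates hS (hwS t ht)).isTiling hL
      w.finite_toSet hS hwS

theorem numTilings_image_shape (hS : ∀ s ∈ S, s.IsThick) (hfin : S.Finite) (hL : 0 < L) :
    numTilings (shape '' S) (rect L) =
      {w | Spans 0 w (fun _ => L) ∧ ∀ t ∈ w, t ∈ translates S}.encard := by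
  have hthick {w : List StepTile} (hw : ∀ t ∈ w, t ∈ translates S) : ∀ t ∈ w, t.IsThick :=
    fun t ht => isThick_of_mem_translates hS (hw t ht)
  have himage : {P | IsTiling (shape '' S) (rect L) P} =
      (fun w => shape '' {t | t ∈ w}) ''
        {w | Spans 0 w (fun _ => L) ∧ ∀ t ∈ w, t ∈ translates S} :=
    Set.ext fun P => isTiling_image_shape_iff hS hfin hL
  rw [numTilings, himage, Set.InjOn.encard_image]
  rintro w ⟨hw, hwS⟩ w' ⟨hw', hwS'⟩ heq
  refine hw.eq_of_mem_iff hw' (hthick hwS) fun t => ?_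
  exact Set.ext_iff.1 ((IsThick.shape_injOn.image_eq_image_iff (hthick hwS) (hthick hwS')).1 heq) t

end StepTile

/-- A directed multigraph in which finitely many edges leave each vertex of `Q`. The edges carry
weights in `M`, and an edge leaving a given vertex is recorded as its weight and its target. -/
abbrev WeightedGraph (Q M : Type*) := Q → Finset (M × Q)

namespace WeightedGraph

section Walks

variable {Q M : Type*} (G : WeightedGraph Q M)

/-- `G.IsWalk q w r`: the consecutive edges `w` lead from the vertex `q` to the vertex `r`. -/
def IsWalk : Q → List (M × Q) → Q → Prop
  | q, [], r => q = r
  | q, a :: w, r => a ∈ G q ∧ IsWalk a.2 w r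

/-- The sum of the weights along a walk. -/
def weight [AddMonoid M] (w : List (M × Q)) : M := (w.map Prod.fst).sum

theorem weight_cons [AddMonoid M] (a : M × Q) (w : List (M × Q)) :
    weight (a :: w) = a.1 + weight w := by
  rw [weight, List.map_cons, List.sum_cons, weight]

/-- The number of walks of weight `t` from `q` to `r`. -/
noncomputable def numWalks [AddMonoid M] (q r : Q) (t : M) : ℕ∞ :=
  {w | G.IsWalk q w r ∧ weight w = t}.encard

theorem numWalks_eq_sum [AddCommGroup M] [DecidableEq M] [DecidableEq Q] (q r : Q) (t : M) :
    G.numWalks q r t =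
      (if q = r ∧ t = 0 then 1 else 0) + ∑ a ∈ G q, G.numWalks a.2 r (t - a.1) := by
  have hsplit : {w | G.IsWalk q w r ∧ weight w = t} = {w | w = [] ∧ q = r ∧ t = 0} ∪
      ⋃ a ∈ (G q : Set (M × Q)), List.cons a '' {w | G.IsWalk a.2 w r ∧ weight w = t - a.1} := by
    ext (_ | ⟨a, w⟩)
    · simp [IsWalk, weight, eq_comm]
    · simp [IsWalk, weight_cons, eq_sub_iff_add_eq', and_assoc, and_left_comm]
  rw [numWalks, hsplit, Set.encard_union_eq, (G q).finite_toSet.encard_biUnion,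
    finsum_mem_coe_finset]
  · congr 1
    · split_ifs with h <;> simp [h]
    · exact Finset.sum_congr rfl fun a _ => List.cons_injective.encard_image _
  · intro a _ b _ hab
    refine Set.disjoint_left.2 ?_
    rintro _ ⟨w, _, rfl⟩ ⟨w', _, heq⟩
    exact hab (List.cons.inj heq).1.symm
  · refine Set.disjoint_left.2 ?_
    rintro _ ⟨rfl, _⟩ h
    simp at h

theorem numWalks_eq_zero {N : Type*} [AddMonoid M] [AddCommMonoid N] [PartialOrder N]
    [IsOrderedAddMonoid N] (f : M →+ N) (hf : ∀ q, ∀ a ∈ G q, 0 ≤ f a.1) {t : M} (ht : ¬0 ≤ f t)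
    (q r : Q) : G.numWalks q r t = 0 := by
  rw [numWalks, Set.encard_eq_zero, Set.eq_empty_iff_forall_notMem]
  rintro w ⟨hw, rfl⟩
  refine ht ?_
  clear ht
  induction w generalizing q with
  | nil => simp [weight]
  | cons a w ih =>
    rw [weight_cons, map_add]
    exact add_nonneg (hf q a hw.1) (ih a.2 hw.2)

end Walks

section Tiles

variable {Q M : Type*} [AddCommMonoid M] (G : WeightedGraph Q M) (φ : M →+ ℝ) (d : Q → ℝ)

/-- The broken line whose upper half is displaced by `d q` with respect to its lower half, at
`x`. -/
def front (q : Q) (x : ℝ) : Fin 2 → ℝ := ![x, x + d q]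

/-- The step tile of the edge `a` leaving `q`: its sides are the fronts of the endpoints of the
edge, so that the tile of an edge can be continued only by tiles of edges leaving its target. -/
def edgeTile (q : Q) (a : M × Q) : StepTile := ⟨front d q 0, front d a.2 (φ a.1)⟩

/-- The step tiles of all edges of the graph. -/
def edgeTiles : Set StepTile := ⋃ q, edgeTile φ d q '' G q

/-- The translates of the tiles of the edges of a walk that starts at `q`, laid out one after the
other from `x` on. -/
def place : Q → ℝ → List (M × Q) → List StepTile
  | _, _, [] => []
  | q, x, a :: w => (edgeTile φ d q a).translate x :: place a.2 (x + φ a.1) w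

variable {G φ d}

theorem front_inj (hd : d.Injective) {q r : Q} {x y : ℝ} :
    front d q x = front d r y ↔ q = r ∧ x = y := by
  constructor
  · intro h
    have hx : x = y := congrFun h 0
    have hxd : x + d q = y + d r := congrFun h 1
    exact ⟨hd (by linarith), hx⟩
  · rintro ⟨rfl, rfl⟩
    rfl

theorem add_front (q : Q) (x y : ℝ) : (fun i => x + front d q y i) = front d q (x + y) := by
  funext i
  fin_cases i
  · rfl
  · exact (add_assoc x y (d q)).symm

theorem left_translate_edgeTile (q : Q) (x : ℝ) (a : M × Q) :
    ((edgeTile φ d q a).translate x).left = front d q x := by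
  rw [StepTile.translate, edgeTile, add_front, add_zero]

theorem right_translate_edgeTile (q : Q) (x : ℝ) (a : M × Q) :
    ((edgeTile φ d q a).translate x).right = front d a.2 (x + φ a.1) :=
  add_front a.2 x (φ a.1)

theorem mem_edgeTiles {t : StepTile} :
    t ∈ edgeTiles G φ d ↔ ∃ q, ∃ a ∈ G q, edgeTile φ d q a = t := by
  simp only [edgeTiles, Set.mem_iUnion, Set.mem_image, Finset.mem_coe]

theorem finite_edgeTiles [Finite Q] : (edgeTiles G φ d).Finite :=
  Set.finite_iUnion fun q => (G q).finite_toSet.image _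

theorem isThick_of_mem_edgeTiles {q₀ : Q} (hd₀ : d q₀ = 0)
    (hd : ∀ q r s, ∀ a ∈ G s, d q - d r < φ a.1) {t : StepTile} (ht : t ∈ edgeTiles G φ d) :
    t.IsThick := by
  obtain ⟨s, a, ha, rfl⟩ := mem_edgeTiles.1 ht
  have hpos := hd q₀ q₀ s a ha
  have hs := hd s q₀ s a ha
  have ha₂ := hd q₀ a.2 s a ha
  have hsa := hd s a.2 s a ha
  rw [hd₀] at hpos hs ha₂
  refine Fin.forall_fin_two.2 ⟨Fin.forall_fin_two.2 ⟨?_, ?_⟩, Fin.forall_fin_two.2 ⟨?_, ?_⟩⟩ <;>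
    simp only [edgeTile, front, Matrix.cons_val_zero, Matrix.cons_val_one] <;> linarith

theorem IsWalk.spans_place {q r : Q} {w : List (M × Q)} (h : G.IsWalk q w r) (x : ℝ) :
    StepTile.Spans (front d q x) (place φ d q x w) (front d r (x + φ (weight w))) := by
  induction w generalizing q x with
  | nil =>
    obtain rfl : q = r := h
    simp [place, StepTile.Spans, weight]
  | cons a w ih =>
    refine ⟨left_translate_edgeTile q x a, ?_⟩
    rw [right_translate_edgeTile, weight_cons, map_add, ← add_assoc]
    exact ih h.2 _

theorem IsWalk.mem_translates {q r : Q} {w : List (M × Q)} (h : G.IsWalk q w r) (x : ℝ) :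
    ∀ t ∈ place φ d q x w, t ∈ StepTile.translates (edgeTiles G φ d) := by
  induction w generalizing q x with
  | nil => simp [place]
  | cons a w ih =>
    exact List.forall_mem_cons.2 ⟨StepTile.mem_translates.2
      ⟨x, _, mem_edgeTiles.2 ⟨q, a, h.1, rfl⟩, rfl⟩, ih h.2 _⟩

theorem exists_isWalk_of_spans (hd : d.Injective) {l : List StepTile} {q r : Q} {x y : ℝ}
    (hl : StepTile.Spans (front d q x) l (front d r y))
    (hmem : ∀ t ∈ l, t ∈ StepTile.translates (edgeTiles G φ d)) :
    ∃ w, (G.IsWalk q w r ∧ x + φ (weight w) = y) ∧ place φ d q x w = l := by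
  induction l generalizing q x with
  | nil =>
    obtain ⟨rfl, rfl⟩ := (front_inj hd).1 hl
    exact ⟨[], ⟨rfl, by simp [weight]⟩, rfl⟩
  | cons t l ih =>
    obtain ⟨ht, hmem'⟩ := List.forall_mem_cons.1 hmem
    obtain ⟨x', _, hs, rfl⟩ := StepTile.mem_translates.1 ht
    obtain ⟨q', a, ha, rfl⟩ := mem_edgeTiles.1 hs
    obtain ⟨hleft, hl⟩ := hl
    rw [left_translate_edgeTile, front_inj hd] at hleft
    obtain ⟨rfl, rfl⟩ := hleft
    rw [right_translate_edgeTile] at hl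
    obtain ⟨w, ⟨hw, rfl⟩, rfl⟩ := ih hl hmem'
    exact ⟨a :: w, ⟨⟨ha, hw⟩, by rw [weight_cons, map_add, add_assoc]⟩, rfl⟩

theorem place_injective (hφ : Function.Injective φ) (hd : d.Injective) (q : Q) (x : ℝ) :
    Function.Injective (place φ d q x) := by
  intro w
  induction w generalizing q x with
  | nil => rintro (_ | ⟨b, w'⟩) h <;> simp_all [place]
  | cons a w ih =>
    rintro (_ | ⟨b, w'⟩) h
    · simp [place] at h
    · obtain ⟨hab, hww'⟩ := List.cons.inj h
      have hright := congrArg StepTile.right hab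
      rw [right_translate_edgeTile, right_translate_edgeTile, front_inj hd] at hright
      obtain rfl : a = b := Prod.ext (hφ (add_left_cancel hright.2)) hright.1
      rw [ih _ _ hww']

theorem numTilings_edgeTiles [Finite Q] (hφ : Function.Injective φ) (hd : d.Injective) {q₀ : Q}
    (hd₀ : d q₀ = 0) (hdφ : ∀ q r s, ∀ a ∈ G s, d q - d r < φ a.1) {t : M} (ht : 0 < φ t) :
    numTilings (StepTile.shape '' edgeTiles G φ d) (rect (φ t)) = G.numWalks q₀ q₀ t := by
  have hfront (x : ℝ) : front d q₀ x = fun _ => x := by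
    ext i
    fin_cases i <;> simp [front, hd₀]
  have himage : {l | StepTile.Spans 0 l (fun _ => φ t) ∧
      ∀ s ∈ l, s ∈ StepTile.translates (edgeTiles G φ d)} =
      place φ d q₀ 0 '' {w | G.IsWalk q₀ w q₀ ∧ weight w = t} := by
    rw [← hfront, show (0 : Fin 2 → ℝ) = front d q₀ 0 from (hfront 0).symm]
    refine Set.Subset.antisymm (fun l ⟨hl, hmem⟩ => ?_) ?_
    · obtain ⟨w, ⟨hw, hweight⟩, rfl⟩ := exists_isWalk_of_spans hd hl hmem
      exact ⟨w, ⟨hw, hφ (by rwa [zero_add] at hweight)⟩, rfl⟩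
    · rintro _ ⟨w, ⟨hw, rfl⟩, rfl⟩
      exact ⟨by simpa only [zero_add] using hw.spans_place 0, hw.mem_translates 0⟩
  rw [StepTile.numTilings_image_shape (fun s hs => isThick_of_mem_edgeTiles hd₀ hdφ hs)
    finite_edgeTiles ht, himage, (place_injective hφ hd q₀ 0).encard_image, numWalks]

theorem exists_injective_small_displacement [Finite Q] (q₀ : Q) {δ : ℝ} (hδ : 0 < δ) :
    ∃ d : Q → ℝ, d.Injective ∧ d q₀ = 0 ∧ ∀ q r, d q - d r < δ := by
  have : Infinite (Set.Ioo 0 δ) := (Set.Ioo_infinite hδ).to_subtype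
  let e : Q ↪ Set.Ioo 0 δ :=
    ((Finite.equivFin Q).toEmbedding.trans Fin.valEmbedding).trans (Infinite.natEmbedding _)
  refine ⟨fun q => e q - e q₀, fun q r h => e.injective (Subtype.ext (sub_left_injective h)),
    sub_self _, fun q r => ?_⟩
  linarith [(e q).2.2, (e r).2.1]

theorem exists_pos_le_edges [Finite Q] (hpos : ∀ q, ∀ a ∈ G q, 0 < φ a.1) :
    ∃ δ > 0, ∀ q, ∀ a ∈ G q, δ ≤ φ a.1 := by
  have hev : ∀ᶠ δ in 𝓝[>] (0 : ℝ), ∀ q, ∀ a ∈ G q, δ ≤ φ a.1 :=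
    Filter.eventually_all.2 fun q => (Filter.eventually_all_finset _).2 fun a ha =>
      Filter.mem_of_superset (Ioc_mem_nhdsGT (hpos q a ha)) fun _ hδ => hδ.2
  obtain ⟨δ, hδ, h⟩ := (eventually_mem_nhdsWithin.and hev).exists
  exact ⟨δ, hδ, h⟩

theorem exists_tiles_numTilings_eq_numWalks [Finite Q] (G : WeightedGraph Q M)
    (hφ : Function.Injective φ) (hpos : ∀ q, ∀ a ∈ G q, 0 < φ a.1) (q₀ : Q) :
    ∃ T : Set (Set (ℝ × ℝ)), T.Finite ∧ (∀ τ ∈ T, IsTallTile τ) ∧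
      ∀ t, 0 < φ t → numTilings T (rect (φ t)) = G.numWalks q₀ q₀ t := by
  obtain ⟨δ, hδ, hδφ⟩ := exists_pos_le_edges hpos
  obtain ⟨d, hd, hd₀, hdδ⟩ := exists_injective_small_displacement q₀ hδ
  have hdφ (q r s : Q) (a : M × Q) (ha : a ∈ G s) : d q - d r < φ a.1 :=
    (hdδ q r).trans_le (hδφ s a ha)
  refine ⟨StepTile.shape '' edgeTiles G φ d, finite_edgeTiles.image _, ?_,
    fun t ht => numTilings_edgeTiles hφ hd hd₀ hdφ ht⟩
  rintro _ ⟨s, hs, rfl⟩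
  exact (isThick_of_mem_edgeTiles hd₀ hdφ hs).isTallTile

end Tiles

end WeightedGraph

/-- The binomial coefficient `m.choose k`, extended by `0` to negative `k`. -/
def binom (m : ℕ) : ℤ → ℕ
  | .ofNat k => m.choose k
  | .negSucc _ => 0

theorem binom_zero (k : ℤ) : binom 0 k = if k = 0 then 1 else 0 := by
  rcases k with (_ | k) | k <;> simp [binom]
  lia

theorem binom_succ (m : ℕ) (k : ℤ) : binom (m + 1) k = binom m k + binom m (k - 1) := by
  rcases k with (_ | k) | k
  · rw [show Int.ofNat 0 - 1 = Int.negSucc 0 by decide]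
    simp [binom]
  · rw [show Int.ofNat (k + 1) - 1 = Int.ofNat k by simp, add_comm (binom m _)]
    exact Nat.choose_succ_succ m k
  · rfl

theorem binom_two_mul_pred (n : ℕ) : binom (2 * n) (n - 1) = (2 * n).choose (n + 1) := by
  rcases n with _ | n
  · rfl
  · rw [show ((n + 1 : ℕ) : ℤ) - 1 = Int.ofNat n by simp]
    exact Nat.choose_symm_of_eq_add (by lia)

/-- The states of the automaton that reads a word of pairs of a colour in `C` and a bit: `base`
stands outside the word, `plain` means that all colours so far are the default one, and
`coloured c` that they are not, the latest colour being `c`. -/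
inductive State (C : Type*)
  | base
  | plain
  | coloured (c : C)
  deriving DecidableEq, Fintype

section Automaton

open State

variable {C : Type*}

/-- The edge that reads one letter, increasing the sum of bits by `l.2`, and passes to the state of
the colour `l.1`. -/
def letterEdge (l : C × ℤ) : (ℤ × ℤ × ℤ) × State C := ((1, l.2, 0), coloured l.1)

theorem letterEdge_injective : Function.Injective (letterEdge (C := C)) := by
  rintro ⟨c, j⟩ ⟨c', j'⟩ h
  simpa [letterEdge, and_comm] using h

variable [Fintype C] [DecidableEq C] (c₀ : C)

/-- The automaton reading words over `C × {0, 1}`, with default colour `c₀`. The weight of an edge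
records the number of letters read, the sum of their bits, and the number of times a word begins or
ends; the first letter of a colour other than `c₀` adds one more to the sum of bits. The states
record the latest colour because edges with the same endpoints must have different weights. -/
def automaton : WeightedGraph (State C) (ℤ × ℤ × ℤ)
  | base => {((0, 0, 1), plain)}
  | plain => {((0, 0, 1), base), ((1, 0, 0), plain), ((1, 1, 0), plain)} ∪
      Finset.image letterEdge ({c₀}ᶜ ×ˢ {1, 2})
  | coloured _ => {((0, 0, 1), base)} ∪
      Finset.image letterEdge (Finset.univ ×ˢ {0, 1})

variable {c₀}

theorem automaton_cases {q : State C} {a : (ℤ × ℤ × ℤ) × State C} (ha : a ∈ automaton c₀ q) :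
    a.1 = (0, 0, 1) ∨ a.1 = (1, 0, 0) ∨ a.1 = (1, 1, 0) ∨ a.1 = (1, 2, 0) := by
  rcases q <;> grind [automaton, letterEdge]

theorem numWalks_eq_zero_of_steps_neg {t : ℤ × ℤ × ℤ} (ht : t.1 < 0) (q r : State C) :
    (automaton c₀).numWalks q r t = 0 := by
  refine WeightedGraph.numWalks_eq_zero _ (AddMonoidHom.fst ℤ (ℤ × ℤ)) (fun q a ha => ?_)
    ht.not_ge q r
  rcases automaton_cases ha with h | h | h | h <;> simp [h]

theorem numWalks_eq_zero_of_markers_neg {t : ℤ × ℤ × ℤ} (ht : t.2.2 < 0) (q r : State C) :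
    (automaton c₀).numWalks q r t = 0 := by
  refine WeightedGraph.numWalks_eq_zero _
    ((AddMonoidHom.snd ℤ ℤ).comp (AddMonoidHom.snd ℤ (ℤ × ℤ))) (fun q a ha => ?_) ht.not_ge q r
  rcases automaton_cases ha with h | h | h | h <;> simp [h]

theorem numWalks_base_base_zero (m k : ℤ) :
    (automaton c₀).numWalks base base (m, k, 0) = if m = 0 ∧ k = 0 then 1 else 0 := by
  rw [WeightedGraph.numWalks_eq_sum, automaton, Finset.sum_singleton,
    numWalks_eq_zero_of_markers_neg (by simp), add_zero]
  simp

theorem numWalks_base_base_two (m k : ℤ) :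
    (automaton c₀).numWalks base base (m, k, 2) =
      (automaton c₀).numWalks plain base (m, k, 1) := by
  rw [WeightedGraph.numWalks_eq_sum, automaton, Finset.sum_singleton]
  simp

theorem numWalks_coloured_base_eq (c : C) (m k : ℤ) :
    (automaton c₀).numWalks (coloured c) base (m, k, 1) =
      (if m = 0 ∧ k = 0 then 1 else 0) +
        ∑ c', ((automaton c₀).numWalks (coloured c') base (m - 1, k, 1) +
          (automaton c₀).numWalks (coloured c') base (m - 1, k - 1, 1)) := by
  rw [WeightedGraph.numWalks_eq_sum, automaton, Finset.sum_union (by simp [letterEdge]),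
    Finset.sum_image letterEdge_injective.injOn, Finset.sum_product]
  simp [letterEdge, numWalks_base_base_zero]

theorem numWalks_plain_base_eq (m k : ℤ) :
    (automaton c₀).numWalks plain base (m, k, 1) =
      (if m = 0 ∧ k = 0 then 1 else 0) +
        ((automaton c₀).numWalks plain base (m - 1, k, 1) +
          (automaton c₀).numWalks plain base (m - 1, k - 1, 1) +
        ∑ c ∈ {c₀}ᶜ, ((automaton c₀).numWalks (coloured c) base (m - 1, k - 1, 1) +
          (automaton c₀).numWalks (coloured c) base (m - 1, k - 2, 1))) := by
  rw [WeightedGraph.numWalks_eq_sum, automaton,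
    Finset.sum_union (by simp [letterEdge, Finset.disjoint_left]),
    Finset.sum_image letterEdge_injective.injOn, Finset.sum_product]
  simp [letterEdge, numWalks_base_base_zero, add_assoc]

theorem numWalks_coloured_base (c : C) (m : ℕ) (k : ℤ) :
    (automaton c₀).numWalks (coloured c) base (m, k, 1) =
      (Fintype.card C ^ m * binom m k : ℕ) := by
  induction m generalizing c k with
  | zero =>
    rw [numWalks_coloured_base_eq, Finset.sum_eq_zero fun c' _ => ?_]
    · simp [binom_zero]
    · rw [numWalks_eq_zero_of_steps_neg (by simp), numWalks_eq_zero_of_steps_neg (by simp),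
        add_zero]
  | succ m ih =>
    rw [numWalks_coloured_base_eq, if_neg (by lia), Nat.cast_succ, add_sub_cancel_right]
    simp only [ih, Finset.sum_const, Finset.card_univ, nsmul_eq_mul, binom_succ]
    push_cast
    ring

theorem numWalks_plain_base (m : ℕ) (k : ℤ) :
    (automaton c₀).numWalks plain base (m, k, 1) =
      (binom m k + (Fintype.card C ^ m - 1) * binom m (k - 1) : ℕ) := by
  induction m generalizing k with
  | zero =>
    rw [numWalks_plain_base_eq, Finset.sum_eq_zero fun c' _ => ?_,
      numWalks_eq_zero_of_steps_neg (by simp), numWalks_eq_zero_of_steps_neg (by simp)]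
    · simp [binom_zero]
    · rw [numWalks_eq_zero_of_steps_neg (by simp), numWalks_eq_zero_of_steps_neg (by simp),
        add_zero]
  | succ m ih =>
    have hpow : Fintype.card C ^ (m + 1) - 1 =
        Fintype.card C ^ m - 1 + (Fintype.card C - 1) * Fintype.card C ^ m := by
      have hcard : 0 < Fintype.card C := Fintype.card_pos_iff.2 ⟨c₀⟩
      have hle := Nat.le_mul_of_pos_left (Fintype.card C ^ m) hcard
      have hpos := Nat.pow_pos (n := m) hcard
      rw [Nat.sub_one_mul, pow_succ']
      lia
    rw [numWalks_plain_base_eq, if_neg (by lia), Nat.cast_succ, add_sub_cancel_right, hpow]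
    simp only [ih, numWalks_coloured_base, Finset.sum_const, Finset.card_compl,
      Finset.card_singleton, nsmul_eq_mul, binom_succ, sub_sub, one_add_one_eq_two]
    push_cast
    ring

theorem numWalks_automaton (n : ℕ) :
    (automaton c₀).numWalks base base (2 * n, n, 2) = catalanLike (Fintype.card C) n := by
  rw [numWalks_base_base_two, ← Nat.cast_two, ← Nat.cast_mul, numWalks_plain_base,
    binom_two_mul_pred]
  rfl

end Automaton

section Lengths

/-- The length of the rectangle tiled by a walk of the given weight in the automaton: a letter with
bit `j` has length `1 / 2 + (2 * j - 1) * x`, and the beginning or end of a word has length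
`x ^ 2`. -/
noncomputable def walkLength (x : ℝ) : ℤ × ℤ × ℤ →+ ℝ :=
  AddMonoidHom.mk' (fun t => t.1 / 2 + (2 * t.2.1 - t.1) * x + t.2.2 * x ^ 2) fun s t => by
    push_cast [Prod.fst_add, Prod.snd_add]
    ring

theorem walkLength_apply (x : ℝ) (m k b : ℤ) :
    walkLength x (m, k, b) = m / 2 + (2 * k - m) * x + b * x ^ 2 := rfl

theorem coeff_eq_zero_of_transcendental {R A : Type*} [CommRing R] [CommRing A] [Algebra R A]
    {x : A} (hx : Transcendental R x) {a b c : R}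
    (h : algebraMap R A a * x ^ 2 + algebraMap R A b * x + algebraMap R A c = 0) :
    a = 0 ∧ b = 0 ∧ c = 0 := by
  have hpoly : (Cubic.mk 0 a b c).toPoly = 0 :=
    transcendental_iff.1 hx _ (by simpa [Cubic.toPoly] using h)
  have hcubic := (Cubic.toPoly_eq_zero_iff _).1 hpoly
  exact ⟨congrArg Cubic.b hcubic, congrArg Cubic.c hcubic, congrArg Cubic.d hcubic⟩

theorem walkLength_injective {x : ℝ} (hx : Transcendental ℤ x) :
    Function.Injective (walkLength x) := by
  rw [injective_iff_map_eq_zero]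
  rintro ⟨m, k, b⟩ h
  rw [walkLength_apply] at h
  have hquad : algebraMap ℤ ℝ (2 * b) * x ^ 2 + algebraMap ℤ ℝ (2 * (2 * k - m)) * x +
      algebraMap ℤ ℝ m = 0 := by
    simp only [algebraMap_int_eq, eq_intCast]
    push_cast
    linarith
  obtain ⟨hb, hk, rfl⟩ := coeff_eq_zero_of_transcendental hx hquad
  rw [Prod.mk_eq_zero, Prod.mk_eq_zero]
  lia

theorem walkLength_pos {x : ℝ} (hx : x ∈ Set.Ioo 0 (1 / 2)) {C : Type*} [Fintype C] [DecidableEq C]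
    (c₀ : C) (q : State C) {a : (ℤ × ℤ × ℤ) × State C} (ha : a ∈ automaton c₀ q) :
    0 < walkLength x a.1 := by
  have hpos := hx.1
  have hlt := hx.2
  rcases automaton_cases ha with h | h | h | h <;> rw [h, walkLength_apply]
  · simpa using pow_pos hpos 2
  all_goals
    push_cast
    linarith

theorem exists_transcendental_mem_Ioo {a b : ℝ} (hab : a < b) :
    ∃ x ∈ Set.Ioo a b, Transcendental ℤ x := by
  obtain ⟨x, htrans, hx⟩ := ((Algebraic.countable ℤ ℝ).dense_compl ℝ).exists_mem_open isOpen_Ioo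
    (Set.nonempty_Ioo.2 hab)
  exact ⟨x, hx, htrans⟩

end Lengths

theorem isTileCountingFunction_catalanLike {p : ℕ} (hp : 0 < p) :
    IsTileCountingFunction (catalanLike p) := by
  obtain ⟨x, hx, htrans⟩ := exists_transcendental_mem_Ioo (show (0 : ℝ) < 1 / 2 by norm_num)
  let c₀ : Fin p := ⟨0, hp⟩
  obtain ⟨T, hT, htall, hnum⟩ := WeightedGraph.exists_tiles_numTilings_eq_numWalks (automaton c₀)
    (walkLength_injective htrans) (fun q _ ha => walkLength_pos hx c₀ q ha) .base
  have hlength (n : ℕ) : walkLength x (2 * n, n, 2) = n + 2 * x ^ 2 := by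
    rw [walkLength_apply]
    push_cast
    ring
  refine ⟨2 * x ^ 2, T, by positivity, hT, htall, fun n => ?_⟩
  have hpos : 0 < walkLength x (2 * n, n, 2) := by
    rw [hlength]
    have := hx.1
    positivity
  rw [← hlength, hnum _ hpos, numWalks_automaton, Fintype.card_fin]

theorem catalanLike_eq_catalan_mul {p : ℕ} (hp : 0 < p) (n : ℕ) :
    catalanLike p n = catalan n * (1 + n * p ^ (2 * n)) := by
  have hcentral : (2 * n).choose n = (n + 1) * catalan n := by
    rw [← Nat.centralBinom_eq_two_mul_choose, ← succ_mul_catalan_eq_centralBinom]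
  have hnext : (2 * n).choose (n + 1) = n * catalan n := by
    have hsucc := Nat.choose_succ_right_eq (2 * n) n
    rw [hcentral, two_mul, Nat.add_sub_cancel] at hsucc
    refine Nat.eq_of_mul_eq_mul_right n.succ_pos ?_
    rw [two_mul, hsucc, Nat.succ_eq_add_one]
    ring
  obtain ⟨k, hk⟩ := Nat.exists_eq_add_of_le' (Nat.pow_pos (n := 2 * n) hp)
  rw [catalanLike, hcentral, hnext, hk, Nat.add_sub_cancel]
  ring

theorem coprime_one_add_mul_pow (p n : ℕ) : p.Coprime (1 + n * p ^ (2 * n)) := by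
  rcases n.eq_zero_or_pos with rfl | hn
  · simp
  · have hdvd : p ∣ n * p ^ (2 * n) := (dvd_pow_self p (by lia)).mul_left n
    obtain ⟨k, hk⟩ := hdvd
    rw [hk]
    simp

theorem emultiplicity_catalanLike {p : ℕ} (hp : 0 < p) (n : ℕ) :
    emultiplicity p (catalanLike p n) = emultiplicity p (catalan n) := by
  rw [catalanLike_eq_catalan_mul hp, emultiplicity_eq_emultiplicity_iff]
  exact fun d => ((coprime_one_add_mul_pow p n).pow_left d).dvd_mul_right

end IrrationalTiling

theorem mainTheorem8_general (p : ℕ) (hp : 0 < p) :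
    (∃ f : ℕ → ℕ, IrrationalTiling.IsTileCountingFunction f ∧
      ∀ n : ℕ, emultiplicity p (f n) = emultiplicity p (catalan n)) ∧
    (IrrationalTiling.IsTileCountingFunction (IrrationalTiling.catalanLike p) ∧
      ∀ n : ℕ, emultiplicity p (IrrationalTiling.catalanLike p n) =
        emultiplicity p (catalan n)) := by
  have hf : IrrationalTiling.IsTileCountingFunction (IrrationalTiling.catalanLike p) ∧
      ∀ n : ℕ, emultiplicity p (IrrationalTiling.catalanLike p n) = emultiplicity p (catalan n) :=
    ⟨IrrationalTiling.isTileCountingFunction_catalanLike hp,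
      IrrationalTiling.emultiplicity_catalanLike hp⟩
  exact ⟨⟨_, hf⟩, hf⟩

/-- The order of `p` in `m` is `emultiplicity p m`, the largest `d` with `p ^ d ∣ m`
(and `⊤` for `m = 0`). -/
theorem mainTheorem8 (p : ℕ) (hp : p.Prime) :
    (∃ f : ℕ → ℕ, IrrationalTiling.IsTileCountingFunction f ∧
      ∀ n : ℕ, emultiplicity p (f n) = emultiplicity p (catalan n)) ∧
    (IrrationalTiling.IsTileCountingFunction (IrrationalTiling.catalanLike p) ∧
      ∀ n : ℕ, emultiplicity p (IrrationalTiling.catalanLike p n) =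
        emultiplicity p (catalan n)) :=
  mainTheorem8_general p hp.pos
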